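/- **Theorem 3.1.** Let $n\ge 2$ and $N,\tau\ge 1$ be integers with $N\ge D(n,\tau)$, where $D(n,2k-1)=2\binom{n+k-2}{n-1}$ and $D(n,2k)=\binom{n+k-1}{n-1}+\binom{n+k-2}{n-1}$ for $k\ge 1$. Let $h:[-1,1]\to[0,+\infty]$ be any function. Let $P_i^{(n)}$ be the Gegenbauer polynomials, defined by $P_0^{(n)}(t)=1$, $P_1^{(n)}(t)=t$ and $(i+n-2)P_{i+1}^{(n)}(t)=(2i+n-2)\,t\,P_i^{(n)}(t)-i\,P_{i-1}^{(n)}(t)$ for $i\ge 1$, and let $f(t)=\sum_{i=0}^{\deg f} f_iP_i^{(n)}(t)$ be a real polynomial with (A2) $f_i\ge 0$ for every $i\ge \tau+1$. A spherical $\tau$-design is a finite set $C\subset\mathbb S^{n-1}\subset\mathbb R^n$ such that $\frac1{\mu(\mathbb S^{n-1})}\int_{\mathbb S^{n-1}}p\,d\mu=\frac1{|C|}\sum_{x\in C}p(x)$ for all real polynomials $p$ in $n$ variables of total degree at most $\tau$, where $\mu$ is the surface area measure. Put $E(n,C;h)=\sum_{x,y\in C,\,x\ne y}h(\langle x,y\rangle)$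 (the sum over ordered pairs). 1. Let $I\subseteq[-1,1)$ be such that (A1) $f(t)\le h(t)$ for all $t\in I$. If $C\subset\mathbb S^{n-1}$ is a spherical $\tau$-design with $|C|=N$ and $\langle x,y\rangle\in I$ for all distinct $x,y\in C$, then $$E(n,C;h)\ \ge\ N\bigl(f_0N-f(1)\bigr).$$ 2. Let $\ell(n,N,\tau)$ be the infimum of $\min_{x\ne y\in C}\langle x,y\rangle$, and $u(n,N,\tau)$ the supremum of $\max_{x\ne y\in C}\langle x,y\rangle$, over all spherical $\tau$-designs $C\subset\mathbb S^{n-1}$ with $|C|=N$. If $f(t)\le h(t)$ for all $t\in[\ell(n,N,\tau),u(n,N,\tau)]$, then $$\mathcal L(n,N,\tau;h)\ \ge\ N\bigl(f_0N-f(1)\bigr),$$ where $\mathcal L(n,N,\tau;h)=\inf\{E(n,C;h): C\subset\mathbb S^{n-1}\text{ a spherical }\tau\text{-design},\ |C|=N\}$. (If there is no such design, then $[\ell,u]$ is read as the empty set and $\mathcal L=+\infty$.) -/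

import Mathlib

open scoped ENNReal Polynomial

noncomputable section

namespace SphericalDesign

/-- The unit sphere `𝕊^{n-1}` in `ℝ^n`, as a type. A spherical code is a `Finset (Sph n)`. -/
abbrev Sph (n : ℕ) : Type := Metric.sphere (0 : EuclideanSpace ℝ (Fin n)) 1

/-- The Gegenbauer polynomials `P_i^{(n)}`, normalized by `P_i^{(n)}(1) = 1` (for `n ≥ 2`): `P_0 = 1`,
`P_1 = t` and `(i + n - 2) P_{i+1} = (2 i + n - 2) t P_i - i P_{i-1}` for `i ≥ 1`
(written below with `i + 1` in the place of `i`). -/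
def gegenbauer (n : ℕ) : ℕ → ℝ[X]
  | 0 => 1
  | 1 => Polynomial.X
  | i + 2 =>
      Polynomial.C (((i + 1 : ℝ) + n - 2)⁻¹) *
        (Polynomial.C (2 * (i + 1 : ℝ) + n - 2) * Polynomial.X * gegenbauer n (i + 1) -
          Polynomial.C (i + 1 : ℝ) * gegenbauer n i)

/-- The Delsarte-Goethals-Seidel number `D(n, τ)`, for `n, τ ≥ 1`:
`2 * binom(n+k-2, n-1)` if `τ = 2k - 1`, and `binom(n+k-1, n-1) + binom(n+k-2, n-1)` if `τ = 2k`. -/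
def dgs (n τ : ℕ) : ℕ :=
  if Odd τ then 2 * (n + (τ + 1) / 2 - 2).choose (n - 1)
  else (n + τ / 2 - 1).choose (n - 1) + (n + τ / 2 - 2).choose (n - 1)

/-- The surface area measure on `𝕊^{n-1}`. -/
def surfaceMeasure (n : ℕ) : MeasureTheory.Measure (Sph n) :=
  (MeasureTheory.volume : MeasureTheory.Measure (EuclideanSpace ℝ (Fin n))).toSphere

/-- `C` is a spherical `τ`-design: each real polynomial in `n` variables of total degree at most `τ`
has the same average over the sphere as over `C`. -/
def IsDesign {n : ℕ} (τ : ℕ) (C : Finset (Sph n)) : Prop :=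
  ∀ p : MvPolynomial (Fin n) ℝ, p.totalDegree ≤ τ →
    ((surfaceMeasure n).real Set.univ)⁻¹ *
        ∫ x : Sph n, MvPolynomial.eval (fun i => (x : EuclideanSpace ℝ (Fin n)) i) p
          ∂(surfaceMeasure n) =
      (C.card : ℝ)⁻¹ *
        ∑ x ∈ C, MvPolynomial.eval (fun i => (x : EuclideanSpace ℝ (Fin n)) i) p

/-- The inner product of two points of the sphere lies in `[-1, 1]`. -/
theorem inner_mem {n : ℕ} (x y : Sph n) :
    inner ℝ (x : EuclideanSpace ℝ (Fin n)) (y : EuclideanSpace ℝ (Fin n)) ∈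
      Set.Icc (-1 : ℝ) 1 := by
  have h := abs_real_inner_le_norm (x : EuclideanSpace ℝ (Fin n)) (y : EuclideanSpace ℝ (Fin n))
  rw [norm_eq_of_mem_sphere, norm_eq_of_mem_sphere, one_mul] at h
  exact abs_le.mp h

/-- The inner product `⟨x, y⟩` of two points of the sphere, as an element of `[-1, 1]`. -/
def ip {n : ℕ} (x y : Sph n) : Set.Icc (-1 : ℝ) 1 :=
  ⟨inner ℝ (x : EuclideanSpace ℝ (Fin n)) (y : EuclideanSpace ℝ (Fin n)), inner_mem x y⟩

open Classical in
/-- The `h`-energy `E(n, C; h)`, the sum of `h(⟨x, y⟩)` over all ordered pairs of distinct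
points of `C`. -/
def energy {n : ℕ} (C : Finset (Sph n)) (h : Set.Icc (-1 : ℝ) 1 → ℝ≥0∞) : ℝ≥0∞ :=
  ∑ q ∈ C.offDiag, h (ip q.1 q.2)

/-- `𝓛(n, N, τ; h)`: the infimum of `E(n, C; h)` over all `τ`-designs `C` on `𝕊^{n-1}` with
`|C| = N` (it is `∞` if there are none). -/
def minEnergy (n N τ : ℕ) (h : Set.Icc (-1 : ℝ) 1 → ℝ≥0∞) : ℝ≥0∞ :=
  sInf {e | ∃ C : Finset (Sph n), C.card = N ∧ IsDesign τ C ∧ e = energy C h}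

/-- `ℓ(C)`: the smallest inner product of distinct points of `C`. For `|C| ≥ 2` this is an infimum
over a nonempty finite set of reals, hence a minimum. -/
def minInner {n : ℕ} (C : Finset (Sph n)) : EReal :=
  sInf {s | ∃ x ∈ C, ∃ y ∈ C, x ≠ y ∧ s = ((ip x y : ℝ) : EReal)}

/-- `u(C)`: the largest inner product of distinct points of `C`. For `|C| ≥ 2` this is a supremum
over a nonempty finite set of reals, hence a maximum. -/
def maxInner {n : ℕ} (C : Finset (Sph n)) : EReal :=
  sSup {s | ∃ x ∈ C, ∃ y ∈ C, x ≠ y ∧ s = ((ip x y : ℝ) : EReal)}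

/-- `ℓ(n, N, τ)`: the infimum of `ℓ(C)` over all `τ`-designs `C` on `𝕊^{n-1}` with `|C| = N`.
It lies in `[-1, 1)` if there are such designs and `N ≥ 2`. -/
def ell (n N τ : ℕ) : EReal :=
  sInf {s | ∃ C : Finset (Sph n), C.card = N ∧ IsDesign τ C ∧ s = minInner C}

/-- `u(n, N, τ)`: the supremum of `u(C)` over all `τ`-designs `C` on `𝕊^{n-1}` with `|C| = N`.
It lies in `[-1, 1]` if there are such designs and `N ≥ 2`. -/
def upp (n N τ : ℕ) : EReal :=
  sSup {s | ∃ C : Finset (Sph n), C.card = N ∧ IsDesign τ C ∧ s = maxInner C}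

end SphericalDesign

end

/-! Sum `f (ip x y)` over all ordered pairs of points of a design `C` and expand in Gegenbauer
polynomials. Degree `0` gives `c 0 * N ^ 2`, degrees `1` to `τ` give zero, higher degrees are
nonnegative by (A2) and positive definiteness. Removing the diagonal, which contributes `N * f(1)`,
leaves a lower bound for the energy.

Both facts about Gegenbauer polynomials come from `zonal`, which homogenizes their recurrence and is
harmonic (`laplacian_zonal`). In the Fischer form the zonal polynomials have Gram matrix `c *
P_i(⟨y, z⟩)` with `c > 0` (`fischer_zonal`), hence positivity. Their sphere mean is zero in positive
degree (`integral_sphere_eq_zero_of_harmonic`), by Gaussian integration by parts and polar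
coordinates, so a design annihilates them up to degree `τ`. -/

noncomputable section

namespace SphericalDesign

open MvPolynomial MeasureTheory

/-! ### The Fischer form and differential operators on polynomials -/

section Fischer

variable {σ : Type*} [Fintype σ]

/-- The Fischer (apolar) bilinear form on real polynomials: distinct monomials are orthogonal and
`x^α` pairs with itself to `α!`. -/
def fischer : MvPolynomial σ ℝ →ₗ[ℝ] MvPolynomial σ ℝ →ₗ[ℝ] ℝ :=
  (basisMonomials σ ℝ).constr ℝ fun α => (∏ i, ((α i).factorial : ℝ)) • lcoeff ℝ α

theorem fischer_monomial (α : σ →₀ ℕ) (a : ℝ) (q : MvPolynomial σ ℝ) :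
    fischer (monomial α a) q = a * ((∏ i, ((α i).factorial : ℝ)) * q.coeff α) := by
  have h : monomial α a = a • basisMonomials σ ℝ α := by
    simp [coe_basisMonomials, smul_monomial]
  rw [h, map_smul, fischer, Module.Basis.constr_basis]
  simp

theorem fischer_self_nonneg (p : MvPolynomial σ ℝ) : 0 ≤ fischer p p := by
  conv_rhs => rw [p.as_sum]
  -- The previous rewrite hits both arguments; only the first is to stay expanded.
  conv_rhs => enter [2]; rw [← p.as_sum]
  rw [map_sum, LinearMap.sum_apply]
  refine Finset.sum_nonneg fun α _ => ?_
  rw [fischer_monomial]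
  have : 0 ≤ ∏ i, ((α i).factorial : ℝ) := by positivity
  nlinarith [mul_nonneg this (mul_self_nonneg (p.coeff α))]

/-- The factorial weights are chosen for this adjointness: `(α i + 1)! = (α i + 1) * (α i)!`
supplies the factor produced by differentiation. -/
theorem fischer_X_mul (i : σ) (p q : MvPolynomial σ ℝ) :
    fischer (X i * p) q = fischer p (pderiv i q) := by
  classical
  induction p using MvPolynomial.induction_on' with
  | monomial α a =>
    rw [mul_comm, ← pow_one (X i), ← monomial_add_single, fischer_monomial, fischer_monomial,
      coeff_pderiv]
    have h : ∏ j, ((((α + Finsupp.single i 1 : σ →₀ ℕ)) j).factorial : ℝ) =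
        (α i + 1) * ∏ j, ((α j).factorial : ℝ) := by
      rw [← Finset.mul_prod_erase _ _ (Finset.mem_univ i),
        ← Finset.mul_prod_erase _ (fun j => ((α j).factorial : ℝ)) (Finset.mem_univ i), ← mul_assoc]
      congr 1
      · simp [Nat.factorial_succ]
      · refine Finset.prod_congr rfl fun j hj => ?_
        rw [Finsupp.add_apply, Finsupp.single_eq_of_ne (Finset.ne_of_mem_erase hj), add_zero]
    rw [h]
    ring
  | add p q hp hq => simp only [mul_add, map_add, LinearMap.add_apply, hp, hq]

/-- The Laplacian of a polynomial. -/
def laplacian (p : MvPolynomial σ ℝ) : MvPolynomial σ ℝ := ∑ i, pderiv i (pderiv i p)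

/-- The derivative of a polynomial in direction `y`. -/
def dirDeriv (y : σ → ℝ) (p : MvPolynomial σ ℝ) : MvPolynomial σ ℝ := ∑ i, C (y i) * pderiv i p

/-- The linear form `⟨y, x⟩`. -/
def linForm (y : σ → ℝ) : MvPolynomial σ ℝ := ∑ i, C (y i) * X i

variable (σ) in
/-- The quadratic form `⟨x, x⟩`. -/
def sqNorm : MvPolynomial σ ℝ := ∑ i, X i * X i

theorem linForm_isHomogeneous (y : σ → ℝ) : (linForm y).IsHomogeneous 1 :=
  IsHomogeneous.sum _ _ _ fun i _ => by
    simpa using (isHomogeneous_C σ (y i)).mul (isHomogeneous_X ℝ i)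

variable (σ) in
theorem sqNorm_isHomogeneous : (sqNorm σ).IsHomogeneous 2 :=
  IsHomogeneous.sum _ _ _ fun i _ => (isHomogeneous_X ℝ i).mul (isHomogeneous_X ℝ i)

theorem pderiv_linForm (y : σ → ℝ) (i : σ) : pderiv i (linForm y) = C (y i) := by
  classical
  simp [linForm, pderiv_X, Pi.single_apply]

theorem pderiv_sqNorm (i : σ) : pderiv i (sqNorm σ) = 2 * X i := by
  classical
  simp [sqNorm, pderiv_X, Pi.single_apply, Finset.sum_add_distrib, two_mul]

theorem fischer_linForm_mul (y : σ → ℝ) (p q : MvPolynomial σ ℝ) :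
    fischer (linForm y * p) q = fischer p (dirDeriv y q) := by
  simp only [linForm, dirDeriv, Finset.sum_mul, map_sum, LinearMap.sum_apply,
    ← smul_eq_C_mul, map_smul, LinearMap.smul_apply, fischer_X_mul, smul_mul_assoc]

theorem fischer_sqNorm_mul (p q : MvPolynomial σ ℝ) :
    fischer (sqNorm σ * p) q = fischer p (laplacian q) := by
  simp only [sqNorm, laplacian, Finset.sum_mul, map_sum, LinearMap.sum_apply, mul_assoc,
    fischer_X_mul]

/-- Each factor `linForm y` moves across as a derivative along `y`; Euler's identity at `y` then
produces the degree, and the degrees multiply to `k!`. -/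
theorem fischer_linForm_pow (y : σ → ℝ) (k : ℕ) {q : MvPolynomial σ ℝ} (hq : q.IsHomogeneous k) :
    fischer (linForm y ^ k) q = k.factorial * eval y q := by
  induction k generalizing q with
  | zero =>
    rw [totalDegree_eq_zero_iff_eq_C.mp (Nat.le_zero.mp hq.totalDegree_le), pow_zero, show (1 : MvPolynomial σ ℝ) = monomial 0 1 from rfl, fischer_monomial]
    simp
  | succ k ih =>
    have hd : (dirDeriv y q).IsHomogeneous k :=
      IsHomogeneous.sum _ _ _ fun i _ => by
        simpa using (isHomogeneous_C σ (y i)).mul (hq.pderiv (i := i))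
    rw [pow_succ', fischer_linForm_mul, ih hd, Nat.factorial_succ]
    have := congrArg (eval y) hq.sum_X_mul_pderiv
    simp only [map_sum, map_mul, eval_X, nsmul_eq_mul, map_natCast] at this
    simp only [dirDeriv, map_sum, map_mul, eval_C, this]
    push_cast
    ring

theorem laplacian_linForm_mul (y : σ → ℝ) (p : MvPolynomial σ ℝ) :
    laplacian (linForm y * p) = linForm y * laplacian p + 2 * dirDeriv y p := by
  simp only [laplacian, dirDeriv, pderiv_mul, map_add, pderiv_linForm, pderiv_C, Finset.mul_sum,
    ← Finset.sum_add_distrib]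
  exact Finset.sum_congr rfl fun i _ => by ring

theorem laplacian_sqNorm_mul {d : ℕ} {p : MvPolynomial σ ℝ} (hp : p.IsHomogeneous d) :
    laplacian (sqNorm σ * p) =
      sqNorm σ * laplacian p + (2 * (Fintype.card σ : MvPolynomial σ ℝ) + 4 * d) * p := by
  have h := hp.sum_X_mul_pderiv
  rw [nsmul_eq_mul] at h
  have h2 : ∀ i, pderiv i (pderiv i (sqNorm σ * p)) =
      2 * p + 4 * (X i * pderiv i p) + sqNorm σ * pderiv i (pderiv i p) := fun i => by
    have : pderiv i (2 : MvPolynomial σ ℝ) = 0 := by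
      rw [show (2 : MvPolynomial σ ℝ) = C 2 from rfl, pderiv_C]
    simp only [pderiv_mul, map_add, pderiv_sqNorm, pderiv_X_self, this]
    ring
  simp only [laplacian, h2, Finset.sum_add_distrib, ← Finset.mul_sum, h]
  simp
  ring

theorem dirDeriv_mul (y : σ → ℝ) (p q : MvPolynomial σ ℝ) :
    dirDeriv y (p * q) = dirDeriv y p * q + p * dirDeriv y q := by
  simp only [dirDeriv, pderiv_mul, Finset.sum_mul, Finset.mul_sum, ← Finset.sum_add_distrib]
  exact Finset.sum_congr rfl fun i _ => by ring

theorem dirDeriv_C (y : σ → ℝ) (a : ℝ) : dirDeriv y (C a) = 0 := by simp [dirDeriv]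

theorem dirDeriv_sub (y : σ → ℝ) (p q : MvPolynomial σ ℝ) :
    dirDeriv y (p - q) = dirDeriv y p - dirDeriv y q := by
  simp [dirDeriv, mul_sub, Finset.sum_sub_distrib]

theorem dirDeriv_linForm {y : σ → ℝ} (hy : ∑ i, y i * y i = 1) :
    dirDeriv y (linForm y) = 1 := by
  simp only [dirDeriv, pderiv_linForm, ← C_mul, ← map_sum, hy, C_1]

theorem dirDeriv_sqNorm (y : σ → ℝ) : dirDeriv y (sqNorm σ) = 2 * linForm y := by
  simp only [dirDeriv, pderiv_sqNorm, linForm, Finset.mul_sum]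
  exact Finset.sum_congr rfl fun i _ => by ring

theorem laplacian_C_mul (a : ℝ) (p : MvPolynomial σ ℝ) :
    laplacian (C a * p) = C a * laplacian p := by
  simp [laplacian, Finset.mul_sum]

theorem laplacian_sub (p q : MvPolynomial σ ℝ) :
    laplacian (p - q) = laplacian p - laplacian q := by
  simp [laplacian, Finset.sum_sub_distrib]

end Fischer

/-! ### Zonal harmonics and positive definiteness -/

/-- The zonal polynomial with pole `y`: the homogenization `|x|^i P_i^{(n)}(⟨y, x⟩ / |x|)`. -/
def zonal {n : ℕ} (y : Fin n → ℝ) : ℕ → MvPolynomial (Fin n) ℝ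
  | 0 => 1
  | 1 => linForm y
  | i + 2 =>
      C (((i + 1 : ℝ) + n - 2)⁻¹) *
        (C (2 * (i + 1 : ℝ) + n - 2) * (linForm y * zonal y (i + 1)) -
          C (i + 1 : ℝ) * (sqNorm (Fin n) * zonal y i))

section Zonal

variable {n : ℕ} (y : Fin n → ℝ)

theorem zonal_isHomogeneous (i : ℕ) : (zonal y i).IsHomogeneous i := by
  induction i using Nat.twoStepInduction with
  | zero => exact isHomogeneous_one _ _
  | one => exact linForm_isHomogeneous y
  | more i h0 h1 =>
    have e1 := (linForm_isHomogeneous y).mul h1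
    have e2 := (sqNorm_isHomogeneous (Fin n)).mul h0
    rw [show 1 + (i + 1) = i + 2 by omega] at e1
    rw [add_comm 2 i] at e2
    rw [zonal]
    have := (isHomogeneous_C (Fin n) (((i + 1 : ℝ) + n - 2)⁻¹)).mul
      (((isHomogeneous_C (Fin n) (2 * (i + 1 : ℝ) + n - 2)).mul e1).sub
        (by simpa using (isHomogeneous_C (Fin n) (i + 1 : ℝ)).mul e2))
    simpa using this

theorem eval_zonal {x : Fin n → ℝ} (hx : ∑ i, x i * x i = 1) (i : ℕ) :
    eval x (zonal y i) = (gegenbauer n i).eval (∑ j, y j * x j) := by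
  have hR : eval x (sqNorm (Fin n)) = 1 := by simpa [sqNorm] using hx
  have hL : eval x (linForm y) = ∑ j, y j * x j := by simp [linForm]
  induction i using Nat.twoStepInduction with
  | zero => simp [zonal, gegenbauer]
  | one => simp [zonal, gegenbauer, hL]
  | more i h0 h1 =>
    simp only [zonal, gegenbauer, map_mul, map_sub, eval_C, h0, h1, hR, hL, Polynomial.eval_mul,
      Polynomial.eval_sub, Polynomial.eval_C, Polynomial.eval_X]
    ring

theorem zonal_coeff_pos (hn : 2 ≤ n) (i : ℕ) : (0 : ℝ) < (i + 1 : ℝ) + n - 2 := by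
  have : (2 : ℝ) ≤ n := by exact_mod_cast hn
  have : (0 : ℝ) ≤ i := i.cast_nonneg
  linarith

theorem zonal_recurrence (hn : 2 ≤ n) (i : ℕ) :
    C ((i + 1 : ℝ) + n - 2) * zonal y (i + 2) =
      C (2 * (i + 1 : ℝ) + n - 2) * (linForm y * zonal y (i + 1)) -
        C (i + 1 : ℝ) * (sqNorm (Fin n) * zonal y i) := by
  rw [zonal, ← mul_assoc, ← C_mul, mul_inv_cancel₀ (zonal_coeff_pos hn i).ne', C_1, one_mul]

theorem C_zonal_coeff_ne_zero (hn : 2 ≤ n) (i : ℕ) :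
    (C ((i + 1 : ℝ) + n - 2) : MvPolynomial (Fin n) ℝ) ≠ 0 := by
  rw [Ne, C_eq_zero]
  exact (zonal_coeff_pos hn i).ne'

variable {y}

/-- This evaluates the cross term in the Laplacian of `linForm y * zonal y (i + 1)`. -/
theorem dirDeriv_zonal (hn : 2 ≤ n) (hy : ∑ i, y i * y i = 1) (i : ℕ) :
    dirDeriv y (zonal y (i + 1)) = ((i : MvPolynomial (Fin n) ℝ) + 1) * zonal y i := by
  induction i using Nat.strong_induction_on with
  | _ i ih =>
  rcases i with _ | i
  · simp [zonal, dirDeriv_linForm hy]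
  refine mul_left_cancel₀ (C_zonal_coeff_ne_zero hn i) ?_
  have hc : ∀ (a : ℝ) p, dirDeriv y (C a * p) = C a * dirDeriv y p := fun a p => by
    rw [dirDeriv_mul, dirDeriv_C, zero_mul, zero_add]
  have h1 := congrArg (dirDeriv y) (zonal_recurrence y hn i)
  rw [dirDeriv_sub, hc, hc, hc,
    dirDeriv_mul, dirDeriv_mul, dirDeriv_linForm hy, dirDeriv_sqNorm, ih i (by omega)] at h1
  simp only [map_add, map_sub, map_mul, map_natCast, map_one, map_ofNat] at h1 ⊢
  -- The lower term `zonal y i` is constant for `i = 0`; otherwise its derivative comes from the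
  -- induction hypothesis, and the recurrence one index lower eliminates `sqNorm`.
  rcases i with _ | j
  · simp only [zonal, dirDeriv_C, ← C_1, Nat.cast_zero, zero_add, mul_zero, add_zero] at h1 ⊢
    simp only [C_1] at h1 ⊢
    push_cast
    linear_combination h1
  · have h2 := ih j (by omega)
    have h3 := zonal_recurrence y hn j
    simp only [map_add, map_sub, map_mul, map_natCast, map_one, map_ofNat] at h3
    rw [h2] at h1
    push_cast at h1 h2 h3 ⊢
    simp only [show j + 1 + 1 = j + 2 from rfl] at *
    linear_combination h1 - ((j : MvPolynomial (Fin n) ℝ) + 1 + 1) * h3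

/-- Applying the Laplacian to the recurrence leaves two multiples of `zonal y i`, with coefficients
`2(2i+n)(i+1)` and `-(i+1)(2n+4i)`, which cancel. -/
theorem laplacian_zonal (hn : 2 ≤ n) (hy : ∑ i, y i * y i = 1) (i : ℕ) :
    laplacian (zonal y i) = 0 := by
  induction i using Nat.twoStepInduction with
  | zero => simp [laplacian, zonal]
  | one => simp [laplacian, zonal, pderiv_linForm]
  | more i h0 h1 =>
    refine mul_left_cancel₀ (C_zonal_coeff_ne_zero hn i) ?_
    have h := congrArg laplacian (zonal_recurrence y hn i)
    rw [laplacian_sub,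
      laplacian_C_mul, laplacian_C_mul, laplacian_C_mul, laplacian_linForm_mul,
      laplacian_sqNorm_mul (zonal_isHomogeneous y i), h0, h1, dirDeriv_zonal hn hy] at h
    simp only [map_add, map_sub, map_mul, map_natCast, map_one, map_ofNat, Fintype.card_fin] at h ⊢
    linear_combination h

/-- Multiples of `sqNorm` are Fischer-orthogonal to harmonic polynomials, so only the power of
`linForm y` matters below. The constant must not depend on `y`. -/
theorem exists_zonal_eq (hn : 2 ≤ n) (i : ℕ) :
    ∃ c : ℝ, 0 < c ∧ ∀ y : Fin n → ℝ, ∃ q : MvPolynomial (Fin n) ℝ,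
      zonal y i = C c * linForm y ^ i + sqNorm (Fin n) * q := by
  induction i using Nat.twoStepInduction with
  | zero => exact ⟨1, one_pos, fun y => ⟨0, by simp [zonal]⟩⟩
  | one => exact ⟨1, one_pos, fun y => ⟨0, by simp [zonal]⟩⟩
  | more i _ h1 =>
    obtain ⟨c, hc, h⟩ := h1
    have hp := zonal_coeff_pos hn i
    have hi : (0 : ℝ) ≤ i := i.cast_nonneg
    refine ⟨((i + 1 : ℝ) + n - 2)⁻¹ * (2 * (i + 1 : ℝ) + n - 2) * c,
      mul_pos (mul_pos (inv_pos.mpr hp) (by linarith)) hc, fun y => ?_⟩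
    obtain ⟨q, hq⟩ := h y
    refine ⟨C (((i + 1 : ℝ) + n - 2)⁻¹) * (C (2 * (i + 1 : ℝ) + n - 2) * (linForm y * q) -
      C (i + 1 : ℝ) * zonal y i), ?_⟩
    rw [zonal, hq, C_mul, C_mul]
    ring

theorem fischer_zonal (hn : 2 ≤ n) (i : ℕ) :
    ∃ c : ℝ, 0 < c ∧ ∀ y z : Fin n → ℝ, ∑ j, y j * y j = 1 → ∑ j, z j * z j = 1 →
      fischer (zonal y i) (zonal z i) = c * (gegenbauer n i).eval (∑ j, y j * z j) := by
  obtain ⟨c, hc, h⟩ := exists_zonal_eq hn i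
  refine ⟨c * i.factorial, by positivity, fun y z hy hz => ?_⟩
  obtain ⟨q, hq⟩ := h y
  rw [hq, map_add, LinearMap.add_apply, fischer_sqNorm_mul, laplacian_zonal hn hz, map_zero,
    add_zero, ← smul_eq_C_mul, map_smul, LinearMap.smul_apply,
    fischer_linForm_pow y i (zonal_isHomogeneous z i), eval_zonal z hy, smul_eq_mul, mul_assoc]
  simp only [mul_comm (z _)]

/-- Schoenberg: the Gegenbauer polynomials are positive definite on the sphere. -/
theorem sum_gegenbauer_nonneg (hn : 2 ≤ n) (i : ℕ) {ι : Type*} (s : Finset ι)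
    (v : ι → Fin n → ℝ) (hv : ∀ a ∈ s, ∑ j, v a j * v a j = 1) :
    0 ≤ ∑ a ∈ s, ∑ b ∈ s, (gegenbauer n i).eval (∑ j, v a j * v b j) := by
  obtain ⟨c, hc, h⟩ := fischer_zonal hn i
  have h0 := fischer_self_nonneg (∑ a ∈ s, zonal (v a) i)
  simp only [map_sum, LinearMap.sum_apply] at h0
  rw [Finset.sum_congr rfl fun a ha => Finset.sum_congr rfl fun b hb =>
    h (v b) (v a) (hv b hb) (hv a ha)] at h0
  simp only [← Finset.mul_sum] at h0
  rw [Finset.sum_comm] at h0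
  exact (mul_nonneg_iff_of_pos_left hc).mp h0

end Zonal

/-! ### Gaussian integrals of polynomials -/

section Gaussian

theorem integrable_pow_mul_exp_neg_sq (k : ℕ) :
    Integrable fun t : ℝ => t ^ k * Real.exp (-1 * t ^ 2) := by
  have hk : (-1 : ℝ) < k := by have : (0 : ℝ) ≤ k := k.cast_nonneg; linarith
  simpa only [Real.rpow_natCast] using integrable_rpow_mul_exp_neg_mul_sq one_pos hk

/-- The derivative of `t ^ k * exp (-t ^ 2)` has integral zero. At `k = 0` the truncated `k - 1` is
harmless, its coefficient being zero. -/
theorem two_mul_integral_pow_succ_mul_exp_neg_sq (k : ℕ) :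
    2 * ∫ t : ℝ, t ^ (k + 1) * Real.exp (-1 * t ^ 2) =
      k * ∫ t : ℝ, t ^ (k - 1) * Real.exp (-1 * t ^ 2) := by
  have h1 := (integrable_pow_mul_exp_neg_sq (k - 1)).const_mul (k : ℝ)
  have h2 := (integrable_pow_mul_exp_neg_sq (k + 1)).const_mul (2 : ℝ)
  have h := integral_eq_zero_of_hasDerivAt_of_integrable
    (f := fun t : ℝ => t ^ k * Real.exp (-1 * t ^ 2))
    (fun t => ?_) (h1.sub h2) (integrable_pow_mul_exp_neg_sq k)
  · rw [integral_sub' h1 h2, integral_const_mul, integral_const_mul] at h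
    linarith
  · have e := (((hasDerivAt_pow 2 t).const_mul (-1 : ℝ)).exp)
    refine ((hasDerivAt_pow k t).mul e).congr_deriv ?_
    simp only [Pi.sub_apply, Nat.cast_ofNat, Nat.add_one_sub_one, pow_one]
    ring

variable {σ : Type*} [Fintype σ]

/-- The (unnormalized) Gaussian integral of a polynomial. -/
def gaussInt (p : MvPolynomial σ ℝ) : ℝ :=
  ∫ v : σ → ℝ, eval v p * ∏ i, Real.exp (-1 * v i ^ 2)

theorem eval_monomial_mul_prod_exp (α : σ →₀ ℕ) (a : ℝ) (v : σ → ℝ) :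
    eval v (monomial α a) * ∏ i, Real.exp (-1 * v i ^ 2) =
      a * ∏ i, (v i ^ α i * Real.exp (-1 * v i ^ 2)) := by
  rw [eval_monomial, Finsupp.prod_fintype _ _ (by simp), mul_assoc, Finset.prod_mul_distrib]

theorem integrable_eval_mul_prod_exp (p : MvPolynomial σ ℝ) :
    Integrable fun v : σ → ℝ => eval v p * ∏ i, Real.exp (-1 * v i ^ 2) := by
  induction p using MvPolynomial.induction_on' with
  | monomial α a =>
    simp only [eval_monomial_mul_prod_exp]
    exact (Integrable.fintype_prod fun i => integrable_pow_mul_exp_neg_sq (α i)).const_mul a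
  | add p q hp hq => 
    simp only [map_add, add_mul]
    exact hp.add hq

theorem gaussInt_add (p q : MvPolynomial σ ℝ) : gaussInt (p + q) = gaussInt p + gaussInt q := by
  simp only [gaussInt, map_add, add_mul]
  exact integral_add (integrable_eval_mul_prod_exp p) (integrable_eval_mul_prod_exp q)

theorem gaussInt_sum {ι : Type*} (s : Finset ι) (p : ι → MvPolynomial σ ℝ) :
    gaussInt (∑ a ∈ s, p a) = ∑ a ∈ s, gaussInt (p a) := by
  simp only [gaussInt, map_sum, Finset.sum_mul]
  exact integral_finsetSum _ fun a _ => integrable_eval_mul_prod_exp (p a)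

theorem gaussInt_natCast_mul (k : ℕ) (p : MvPolynomial σ ℝ) :
    gaussInt ((k : MvPolynomial σ ℝ) * p) = k * gaussInt p := by
  simp only [gaussInt, map_mul, map_natCast, mul_assoc]
  exact integral_const_mul _ _

theorem gaussInt_monomial (α : σ →₀ ℕ) (a : ℝ) :
    gaussInt (monomial α a) = a * ∏ i, ∫ t : ℝ, t ^ α i * Real.exp (-1 * t ^ 2) := by
  simp only [gaussInt, eval_monomial_mul_prod_exp]
  rw [integral_const_mul,
    integral_fintype_prod_volume_eq_prod fun i (t : ℝ) => t ^ α i * Real.exp (-1 * t ^ 2)]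

theorem two_mul_gaussInt_X_mul (i : σ) (p : MvPolynomial σ ℝ) :
    2 * gaussInt (X i * p) = gaussInt (pderiv i p) := by
  classical
  induction p using MvPolynomial.induction_on' with
  | monomial α a =>
    rw [mul_comm (X i), ← pow_one (X i), ← monomial_add_single, pderiv_monomial,
      gaussInt_monomial, gaussInt_monomial, ← Finset.mul_prod_erase _
        (fun j => ∫ t : ℝ, t ^ (α + Finsupp.single i 1 : σ →₀ ℕ) j * Real.exp (-1 * t ^ 2))
        (Finset.mem_univ i)]
    rw [← Finset.mul_prod_erase _
      (fun j => ∫ t : ℝ, t ^ (α - Finsupp.single i 1 : σ →₀ ℕ) j * Real.exp (-1 * t ^ 2))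
      (Finset.mem_univ i)]
    have h := two_mul_integral_pow_succ_mul_exp_neg_sq (α i)
    have e : ∏ j ∈ Finset.univ.erase i,
          ∫ t : ℝ, t ^ (α + Finsupp.single i 1 : σ →₀ ℕ) j * Real.exp (-1 * t ^ 2) =
        ∏ j ∈ Finset.univ.erase i,
          ∫ t : ℝ, t ^ (α - Finsupp.single i 1 : σ →₀ ℕ) j * Real.exp (-1 * t ^ 2) :=
      Finset.prod_congr rfl fun j hj => by
        rw [Finsupp.add_apply, Finsupp.tsub_apply,
          Finsupp.single_eq_of_ne (Finset.ne_of_mem_erase hj), add_zero, tsub_zero]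
    rw [e, Finsupp.add_apply, Finsupp.tsub_apply, Finsupp.single_eq_same]
    linear_combination a * (∏ j ∈ Finset.univ.erase i,
          ∫ t : ℝ, t ^ (α - Finsupp.single i 1 : σ →₀ ℕ) j * Real.exp (-1 * t ^ 2)) * h
  | add p q hp hq => rw [mul_add, gaussInt_add, map_add, gaussInt_add, mul_add, hp, hq]

/-- Euler's identity and integration by parts give `2 * k * gaussInt q = gaussInt (laplacian q)`. -/
theorem gaussInt_eq_zero_of_harmonic {k : ℕ} (hk : k ≠ 0) {q : MvPolynomial σ ℝ}
    (hq : q.IsHomogeneous k) (hΔ : laplacian q = 0) : gaussInt q = 0 := by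
  have h := congrArg gaussInt hq.sum_X_mul_pderiv
  rw [nsmul_eq_mul, gaussInt_natCast_mul, gaussInt_sum] at h
  have h2 : 2 * ∑ i, gaussInt (X i * pderiv i q) = 0 := by
    simp only [Finset.mul_sum, two_mul_gaussInt_X_mul]
    rw [← gaussInt_sum, ← laplacian, hΔ]
    simp [gaussInt]
  rw [h] at h2
  have : (k : ℝ) ≠ 0 := by exact_mod_cast hk
  simpa [this] using h2

end Gaussian

/-! ### From Gaussian to spherical integrals by polar coordinates -/

section Sphere

theorem eval_smul_of_isHomogeneous {σ : Type*} {k : ℕ} {q : MvPolynomial σ ℝ}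
    (hq : q.IsHomogeneous k) (r : ℝ) (v : σ → ℝ) :
    eval (fun i => r * v i) q = r ^ k * eval v q := by
  rw [eval_eq, eval_eq, Finset.mul_sum]
  refine Finset.sum_congr rfl fun d hd => ?_
  have := hq (mem_support_iff.mp hd)
  rw [Finsupp.weight_apply, Finsupp.sum] at this
  simp only [mul_pow, Finset.prod_mul_distrib, Finset.prod_pow_eq_pow_sum]
  rw [show ∑ i ∈ d.support, d i = k by simpa using this]
  ring

/-- Positivity allows the radial factor to be cancelled, so a vanishing Gaussian integral forces a
vanishing spherical one. -/
theorem integral_radial_pos (m k : ℕ) :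
    0 < ∫ r : Set.Ioi (0 : ℝ), (r : ℝ) ^ k * Real.exp (-1 * (r : ℝ) ^ 2)
      ∂(Measure.volumeIoiPow m) := by
  have h : ∫ r : Set.Ioi (0 : ℝ), (r : ℝ) ^ k * Real.exp (-1 * (r : ℝ) ^ 2)
      ∂(Measure.volumeIoiPow m) =
        ∫ t in Set.Ioi (0 : ℝ), t ^ ((m + k : ℕ) : ℝ) * Real.exp (-1 * t ^ (2 : ℝ)) := by
    simp only [Measure.volumeIoiPow, ENNReal.ofReal]
    rw [integral_withDensity_eq_integral_smul,
      integral_subtype_comap measurableSet_Ioi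
        fun t : ℝ => Real.toNNReal (t ^ m) • (t ^ k * Real.exp (-1 * t ^ 2)),
      setIntegral_congr_fun measurableSet_Ioi fun t ht => ?_]
    · rw [NNReal.smul_def, Real.coe_toNNReal _ (pow_nonneg (Set.mem_Ioi.mp ht).le _),
        Real.rpow_natCast, Real.rpow_two, smul_eq_mul, pow_add, mul_assoc]
    · exact (measurable_subtype_coe.pow_const _).real_toNNReal
  have hp : (0 : ℝ) ≤ ((m + k : ℕ) : ℝ) := Nat.cast_nonneg _
  rw [h, integral_rpow_mul_exp_neg_mul_rpow two_pos (by linarith) one_pos]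
  have := Real.Gamma_pos_of_pos (s := (((m + k : ℕ) : ℝ) + 1) / 2) (by positivity)
  positivity

variable {n : ℕ}

instance : IsFiniteMeasure (surfaceMeasure n) :=
  inferInstanceAs (IsFiniteMeasure (Measure.toSphere _))

theorem gaussInt_eq_sphere_mul_radial (hn : 0 < n) {k : ℕ} {q : MvPolynomial (Fin n) ℝ}
    (hq : q.IsHomogeneous k) :
    gaussInt q =
      (∫ x : Sph n, eval (fun i => (x : EuclideanSpace ℝ (Fin n)) i) q ∂(surfaceMeasure n)) *
        ∫ r : Set.Ioi (0 : ℝ), (r : ℝ) ^ k * Real.exp (-1 * (r : ℝ) ^ 2)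
          ∂(Measure.volumeIoiPow (Module.finrank ℝ (EuclideanSpace ℝ (Fin n)) - 1)) := by
  let F : EuclideanSpace ℝ (Fin n) → ℝ := fun x =>
    eval (fun i => x i) q * Real.exp (-1 * ‖x‖ ^ 2)
  have : Nonempty (Fin n) := ⟨⟨0, hn⟩⟩
  calc
    gaussInt q = ∫ x, F x := by
      rw [← (PiLp.volume_preserving_toLp (Fin n)).integral_comp
        (MeasurableEquiv.toLp 2 _).measurableEmbedding]
      refine integral_congr_ae (.of_forall fun v => ?_)
      simp only [F, EuclideanSpace.norm_sq_eq, Real.norm_eq_abs, sq_abs, Finset.mul_sum,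
        Real.exp_sum]
    _ = ∫ x : ({0}ᶜ : Set (EuclideanSpace ℝ (Fin n))), F x
          ∂(Measure.comap (↑) (volume : Measure (EuclideanSpace ℝ (Fin n)))) := by
      rw [integral_subtype_comap (measurableSet_singleton _).compl F,
        restrict_compl_singleton]
    _ = ∫ z : Sph n × Set.Ioi (0 : ℝ), F ((z.2 : ℝ) • (z.1 : EuclideanSpace ℝ (Fin n)))
          ∂((surfaceMeasure n).prod (Measure.volumeIoiPow _)) := by
      rw [surfaceMeasure, ← (volume : Measure (EuclideanSpace ℝ (Fin
        n))).measurePreserving_homeomorphUnitSphereProd.integral_comp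
        (Homeomorph.measurableEmbedding _)]
      refine integral_congr_ae (.of_forall fun x => ?_)
      have hx : ‖(x : EuclideanSpace ℝ (Fin n))‖ ≠ 0 := norm_ne_zero_iff.mpr x.2
      simp [smul_smul, hx]
    _ = _ := by
      rw [← integral_prod_mul]
      refine integral_congr_ae (.of_forall fun z => ?_)
      have hr : (0 : ℝ) < z.2 := z.2.2
      simp only [F, norm_smul, norm_eq_of_mem_sphere, mul_one, Real.norm_eq_abs, sq_abs,
        PiLp.smul_apply, smul_eq_mul, eval_smul_of_isHomogeneous hq]
      ring

theorem integral_sphere_eq_zero_of_harmonic (hn : 0 < n) {k : ℕ} (hk : k ≠ 0)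
    {q : MvPolynomial (Fin n) ℝ} (hq : q.IsHomogeneous k) (hΔ : laplacian q = 0) :
    ∫ x : Sph n, eval (fun i => (x : EuclideanSpace ℝ (Fin n)) i) q ∂(surfaceMeasure n) = 0 := by
  have h := gaussInt_eq_sphere_mul_radial hn hq
  rw [gaussInt_eq_zero_of_harmonic hk hq hΔ] at h
  exact (mul_eq_zero.mp h.symm).resolve_right (integral_radial_pos _ k).ne'

end Sphere

/-! ### Linear programming bound for designs -/

variable {n : ℕ}

theorem ip_eq_sum (x y : Sph n) :
    (ip x y : ℝ) =
      ∑ j, (x : EuclideanSpace ℝ (Fin n)) j * (y : EuclideanSpace ℝ (Fin n)) j := by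
  simp [ip, PiLp.inner_apply, mul_comm]

theorem ip_self (x : Sph n) : (ip x x : ℝ) = 1 := by
  simp [ip]

theorem sum_mul_self_eq_one (x : Sph n) :
    ∑ j, (x : EuclideanSpace ℝ (Fin n)) j * (x : EuclideanSpace ℝ (Fin n)) j = 1 := by
  rw [← ip_eq_sum, ip_self]

theorem IsDesign.sum_gegenbauer_eq_zero (hn : 2 ≤ n) {τ : ℕ} {C : Finset (Sph n)}
    (hC : IsDesign τ C) {i : ℕ} (hi : i ≠ 0) (hiτ : i ≤ τ) (y : Sph n) :
    ∑ x ∈ C, (gegenbauer n i).eval (ip y x : ℝ) = 0 := by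
  -- For empty `C` the factor `C.card⁻¹` is `0` and cannot be cancelled.
  rcases C.eq_empty_or_nonempty with rfl | hne
  · simp
  set v : Fin n → ℝ := fun j => (y : EuclideanSpace ℝ (Fin n)) j
  have h := hC (zonal v i) ((zonal_isHomogeneous v i).totalDegree_le.trans hiτ)
  rw [integral_sphere_eq_zero_of_harmonic (by omega) hi (zonal_isHomogeneous v i)
    (laplacian_zonal hn (sum_mul_self_eq_one y) i), mul_zero] at h
  have hc : (C.card : ℝ)⁻¹ ≠ 0 := inv_ne_zero (by exact_mod_cast hne.card_ne_zero)
  have h2 := (mul_eq_zero.mp h.symm).resolve_left hc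
  simpa only [eval_zonal v (sum_mul_self_eq_one _), v, ← ip_eq_sum] using h2

theorem sum_sum_gegenbauer_nonneg (hn : 2 ≤ n) (i : ℕ) (C : Finset (Sph n)) :
    0 ≤ ∑ x ∈ C, ∑ y ∈ C, (gegenbauer n i).eval (ip x y : ℝ) := by
  simp only [ip_eq_sum]
  exact sum_gegenbauer_nonneg hn i C (fun x j => (x : EuclideanSpace ℝ (Fin n)) j)
    fun x _ => sum_mul_self_eq_one x

/-- The linear programming inequality: the average of `f` over pairs of points of a design is at
least the constant Gegenbauer coefficient. -/
theorem IsDesign.le_sum_sum_eval (hn : 2 ≤ n) {τ : ℕ} {C : Finset (Sph n)} (hC : IsDesign τ C)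
    {m : ℕ} {c : ℕ → ℝ} (hc : ∀ i, τ + 1 ≤ i → i ≤ m → 0 ≤ c i) :
    c 0 * (C.card : ℝ) ^ 2 ≤ ∑ x ∈ C, ∑ y ∈ C,
      (∑ i ∈ Finset.range (m + 1), Polynomial.C (c i) * gegenbauer n i).eval (ip x y : ℝ) := by
  have h : ∑ x ∈ C, ∑ y ∈ C,
      (∑ i ∈ Finset.range (m + 1), Polynomial.C (c i) * gegenbauer n i).eval (ip x y : ℝ) =
      ∑ i ∈ Finset.range (m + 1),
        c i * ∑ x ∈ C, ∑ y ∈ C, (gegenbauer n i).eval (ip x y : ℝ) := by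
    simp only [Polynomial.eval_finsetSum, Polynomial.eval_mul, Polynomial.eval_C, Finset.mul_sum]
    rw [Finset.sum_comm]
    conv_rhs => rw [Finset.sum_comm]
    rw [Finset.sum_comm]
    exact Finset.sum_congr rfl fun x _ => Finset.sum_comm
  rw [h, Finset.sum_range_succ']
  have h0 : c 0 * ∑ x ∈ C, ∑ y ∈ C, (gegenbauer n 0).eval (ip x y : ℝ) =
      c 0 * (C.card : ℝ) ^ 2 := by
    simp [gegenbauer, sq]
  rw [h0]
  refine le_add_of_nonneg_left (Finset.sum_nonneg fun i hi => ?_)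
  rcases le_or_gt (i + 1) τ with hiτ | hiτ
  · rw [Finset.sum_eq_zero fun x _ => hC.sum_gegenbauer_eq_zero hn i.succ_ne_zero hiτ x, mul_zero]
  · exact mul_nonneg (hc _ hiτ (Finset.mem_range.mp hi)) (sum_sum_gegenbauer_nonneg hn _ C)

theorem coe_sum_le_energy (C : Finset (Sph n)) (h : Set.Icc (-1 : ℝ) 1 → ℝ≥0∞) (f : ℝ[X])
    (hfh : ∀ x ∈ C, ∀ y ∈ C, x ≠ y → ((f.eval (ip x y : ℝ) : ℝ) : EReal) ≤ (h (ip x y) : EReal)) :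
    ((∑ x ∈ C, ∑ y ∈ C, f.eval (ip x y : ℝ) - C.card * f.eval 1 : ℝ) : EReal) ≤
      (energy C h : EReal) := by
  classical
  have hs : ∑ x ∈ C, ∑ y ∈ C, f.eval (ip x y : ℝ) - C.card * f.eval 1 =
      ∑ q ∈ C.offDiag, f.eval (ip q.1 q.2 : ℝ) := by
    rw [← Finset.sum_product', ← Finset.diag_union_offDiag,
      Finset.sum_union (Finset.disjoint_diag_offDiag _), Finset.sum_diag]
    simp [ip_self]
  rw [hs]
  -- Finite energy makes every summand finite, so the comparison can be made termwise in the reals.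
  by_cases htop : energy C h = ⊤
  · simp [htop]
  have hsum : energy C h = ∑ q ∈ C.offDiag, h (ip q.1 q.2) := by
    rw [energy]
  have hne : ∀ q ∈ C.offDiag, h (ip q.1 q.2) ≠ ⊤ := by
    rw [hsum] at htop
    exact fun q hq => ((ENNReal.sum_ne_top.mp htop) q hq)
  rw [← ENNReal.ofReal_toReal htop, EReal.coe_ennreal_ofReal, max_eq_left ENNReal.toReal_nonneg,
    EReal.coe_le_coe_iff, hsum, ENNReal.toReal_sum hne]
  refine Finset.sum_le_sum fun q hq => ?_
  obtain ⟨h1, h2, h3⟩ := Finset.mem_offDiag.mp hq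
  have := hfh _ h1 _ h2 h3
  rwa [← ENNReal.ofReal_toReal (hne q hq), EReal.coe_ennreal_ofReal,
    max_eq_left ENNReal.toReal_nonneg, EReal.coe_le_coe_iff] at this

theorem IsDesign.le_energy (hn : 2 ≤ n) {τ : ℕ} {C : Finset (Sph n)} (hC : IsDesign τ C)
    (h : Set.Icc (-1 : ℝ) 1 → ℝ≥0∞) (f : ℝ[X]) (c : ℕ → ℝ)
    (hf : f = ∑ i ∈ Finset.range (f.natDegree + 1), Polynomial.C (c i) * gegenbauer n i)
    (hc : ∀ i, τ + 1 ≤ i → i ≤ f.natDegree → 0 ≤ c i)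
    (hfh : ∀ x ∈ C, ∀ y ∈ C, x ≠ y → ((f.eval (ip x y : ℝ) : ℝ) : EReal) ≤ (h (ip x y) : EReal)) :
    (((C.card : ℝ) * (c 0 * (C.card : ℝ) - f.eval 1) : ℝ) : EReal) ≤ (energy C h : EReal) := by
  refine le_trans (EReal.coe_le_coe_iff.mpr ?_) (coe_sum_le_energy C h f hfh)
  have := hC.le_sum_sum_eval hn hc
  rw [← hf] at this
  linarith

theorem ell_le_ip {N τ : ℕ} {C : Finset (Sph n)} (hC : IsDesign τ C) (hN : C.card = N)
    {x y : Sph n} (hx : x ∈ C) (hy : y ∈ C) (hxy : x ≠ y) :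
    ell n N τ ≤ ((ip x y : ℝ) : EReal) :=
  have h1 : ell n N τ ≤ minInner C := sInf_le ⟨C, hN, hC, rfl⟩
  have h2 : minInner C ≤ ((ip x y : ℝ) : EReal) := sInf_le ⟨x, hx, y, hy, hxy, rfl⟩
  h1.trans h2

theorem ip_le_upp {N τ : ℕ} {C : Finset (Sph n)} (hC : IsDesign τ C) (hN : C.card = N)
    {x y : Sph n} (hx : x ∈ C) (hy : y ∈ C) (hxy : x ≠ y) :
    ((ip x y : ℝ) : EReal) ≤ upp n N τ :=
  have h1 : ((ip x y : ℝ) : EReal) ≤ maxInner C := le_sSup ⟨x, hx, y, hy, hxy, rfl⟩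
  have h2 : maxInner C ≤ upp n N τ := le_sSup ⟨C, hN, hC, rfl⟩
  h1.trans h2

theorem le_coe_minEnergy {N τ : ℕ} {h : Set.Icc (-1 : ℝ) 1 → ℝ≥0∞} {a : ℝ}
    (ha : ∀ C : Finset (Sph n), C.card = N → IsDesign τ C → (a : EReal) ≤ (energy C h : EReal)) :
    (a : EReal) ≤ (minEnergy n N τ h : EReal) := by
  -- The infimum is taken in `ℝ≥0∞`, so `a` is truncated at `0`; a negative bound is weaker than
  -- nonnegativity of the energy.
  have key : ENNReal.ofReal a ≤ minEnergy n N τ h := by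
    refine le_sInf ?_
    rintro e ⟨C, hN, hC, rfl⟩
    have := ha C hN hC
    rw [← EReal.coe_ennreal_le_coe_ennreal_iff, EReal.coe_ennreal_ofReal]
    rcases le_total a 0 with h0 | h0
    · rw [max_eq_right h0]
      exact EReal.coe_ennreal_nonneg _
    · rwa [max_eq_left h0]
  refine le_trans ?_ (EReal.coe_ennreal_le_coe_ennreal_iff.mpr key)
  rw [EReal.coe_ennreal_ofReal]
  exact EReal.coe_le_coe_iff.mpr (le_max_left _ _)

end SphericalDesign

end

open SphericalDesign in
theorem theorem3p1 (n N τ : ℕ) (hn : 2 ≤ n) (hN : 0 < N) (hτ : 0 < τ) (hD : dgs n τ ≤ N)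
    (h : Set.Icc (-1 : ℝ) 1 → ℝ≥0∞)
    (f : ℝ[X]) (c : ℕ → ℝ)
    (hf : f = ∑ i ∈ Finset.range (f.natDegree + 1), Polynomial.C (c i) * gegenbauer n i)
    (hA2 : ∀ i, τ + 1 ≤ i → i ≤ f.natDegree → 0 ≤ c i) :
    (∀ I : Set ℝ, I ⊆ Set.Ico (-1 : ℝ) 1 →
      (∀ t : Set.Icc (-1 : ℝ) 1, (t : ℝ) ∈ I → ((f.eval (t : ℝ) : ℝ) : EReal) ≤ (h t : EReal)) →
      ∀ C : Finset (Sph n), IsDesign τ C → C.card = N →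
        (∀ x ∈ C, ∀ y ∈ C, x ≠ y → (ip x y : ℝ) ∈ I) →
        (((N : ℝ) * (c 0 * (N : ℝ) - f.eval 1) : ℝ) : EReal) ≤ (energy C h : EReal)) ∧
    ((∀ t : Set.Icc (-1 : ℝ) 1, ell n N τ ≤ ((t : ℝ) : EReal) → ((t : ℝ) : EReal) ≤ upp n N τ →
        ((f.eval (t : ℝ) : ℝ) : EReal) ≤ (h t : EReal)) →
      (((N : ℝ) * (c 0 * (N : ℝ) - f.eval 1) : ℝ) : EReal) ≤ (minEnergy n N τ h : EReal)) := by
  refine ⟨fun I _ hfh C hC hCN hI => ?_, fun hfh => le_coe_minEnergy fun C hCN hC => ?_⟩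
  · subst hCN
    exact hC.le_energy hn h f c hf hA2 fun x hx y hy hxy => hfh _ (hI x hx y hy hxy)
  -- Every inner product occurring in a competing design lies between `ell` and `upp`, so part 2
  -- applies the same bound to each one.
  · subst hCN
    exact hC.le_energy hn h f c hf hA2 fun x hx y hy hxy =>
      hfh _ (ell_le_ip hC rfl hx hy hxy) (ip_le_upp hC rfl hx hy hxy)
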